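/- For permutations $p=p_1\cdots p_n$ of $\{1,\dots,n\}$ and $q=q_1\cdots q_k$ of $\{1,\dots,k\}$, let $f_q(p)$ be the number of occurrences of $q$ in $p$ as a pattern, i.e. the number of sequences of positions $1\le i_1<\dots<i_k\le n$ such that $p_{i_r}<p_{i_s}$ if and only if $q_r<q_s$. Let $\mathrm{Av}_n(123)$ be the set of permutations $p$ of $\{1,\dots,n\}$ with $f_{123}(p)=0$, and let $$a_n=\sum_{p\in \mathrm{Av}_n(123)}f_{132}(p),\qquad b_n=\sum_{p\in \mathrm{Av}_n(123)}f_{231}(p),\qquad d_n=\sum_{p\in \mathrm{Av}_n(123)}f_{321}(p).$$ Then, with the convention $\binom{m}{k}=0$ for $k<0$: - for all $n\ge 1$, $$a_n=\frac{n+2}{4}\binom{2n}{n}-3\cdot 2^{2n-3};$$ - for all $n\ge 2$, $$b_n=(2n-1)\binom{2n-3}{n-2}-(2n+1)\binom{2n-1}{n-1}+(n+4)\cdot 2^{2n-3};$$ - for all $n\ge 1$, $$d_n=\frac16\binom{2n+5}{n+1}\binom{n+4}{2}-\frac53\binom{2n+3}{n}\binom{n+3}{2}+\frac{17}{3}\binom{2n+1}{n-1}\binom{n+2}{2}-6\binom{2n-1}{n-2}\binom{n+1}{2}-(n+1)\cdot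 4^{n-1}.$$ -/

import Mathlib

namespace PatternTotals

/-- The occurrences of the pattern `q` in the permutation `p` of `{0, …, n - 1}`: the increasing
sequences of positions `s 0 < ⋯ < s (k - 1)` such that the entries of `p` at these positions are
in the same relative order as the entries of `q`. -/
def occurrences {k n : ℕ} (q : Equiv.Perm (Fin k)) (p : Equiv.Perm (Fin n)) :
    Finset (Fin k → Fin n) :=
  {s | (∀ i j, i < j → s i < s j) ∧ ∀ i j, p (s i) < p (s j) ↔ q i < q j}

/-- The number `f_q(p)` of occurrences of `q` in `p` as a pattern. -/
def patternCount {k n : ℕ} (q : Equiv.Perm (Fin k)) (p : Equiv.Perm (Fin n)) : ℕ :=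
  (occurrences q p).card

/-- The set `Av_n(q)` of the permutations of length `n` that contain no occurrence of `q`. -/
def Av (n : ℕ) {k : ℕ} (q : Equiv.Perm (Fin k)) : Finset (Equiv.Perm (Fin n)) :=
  {p | occurrences q p = ∅}

/-- The total number `f_q(C)` of occurrences of `q` in the members of `C`. -/
def patternTotal {k n : ℕ} (q : Equiv.Perm (Fin k)) (C : Finset (Equiv.Perm (Fin n))) : ℕ :=
  ∑ p ∈ C, patternCount q p

/-- The pattern 123; one-line notation is shifted to the values `0, 1, 2`. -/
def p123 : Equiv.Perm (Fin 3) := ⟨![0, 1, 2], ![0, 1, 2], by decide, by decide⟩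

/-- The pattern 132. -/
def p132 : Equiv.Perm (Fin 3) := ⟨![0, 2, 1], ![0, 2, 1], by decide, by decide⟩

/-- The pattern 231. -/
def p231 : Equiv.Perm (Fin 3) := ⟨![1, 2, 0], ![2, 0, 1], by decide, by decide⟩

/-- The pattern 321. -/
def p321 : Equiv.Perm (Fin 3) := ⟨![2, 1, 0], ![2, 1, 0], by decide, by decide⟩

/-- The binomial coefficient with an integer lower index, zero if that index is negative. -/
def binom (m : ℕ) (k : ℤ) : ℚ := if 0 ≤ k then (m.choose k.toNat : ℚ) else 0

end PatternTotals

/-! Three linear relations determine the totals. In a 123-avoider, any two larger entries to the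
right of an entry descend, so they complete a 132; hence `f_132` is the sum of `(upCount p i).choose
2`. Pairing each noninversion with a third position gives `(n-2)N = 4a + 2b`, where `N` is the total
number of noninversions and reverse complement identifies 213 with 132 and 312 with 231. Classifying
all triples gives `n.choose 3 * catalan n = 2a + 2b + d`.

It remains to sum `upCount` and its `choose 2` over the class. Deleting the first entry, with the
number `t` of largest entries forced to decrease as a catalytic parameter, gives a ballot-type
recurrence (`sum_upSum_topDecreasing_succ`). With `y = X * C(X)`, its solution is `r t * y ^ t` for
`r` polynomial in `t`. At `t = 0` the totals are `(B-1)^2/4` and `(B-1)^3/8`, where `B = 1/(1-2y)`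
is the central binomial series, and coefficients of powers of `B` are explicit. -/

namespace PatternTotals

open PowerSeries

/-! ### Catalan and central binomial series; solving the recurrences in `t`. -/

section Series

/-- The series `X * C(X)`, where `C` is the Catalan series. -/
noncomputable def catY : ℚ⟦X⟧ := X * PowerSeries.mk fun n => (catalan n : ℚ)

/-- The generating function of the central binomial coefficients. -/
noncomputable def centralSeries : ℚ⟦X⟧ := PowerSeries.mk fun n => (Nat.centralBinom n : ℚ)

lemma catalan_series_eq :
    (PowerSeries.mk fun n => (catalan n : ℚ)) =
      catY * (PowerSeries.mk fun n => (catalan n : ℚ)) + 1 := by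
  have h := congrArg (PowerSeries.map (Nat.castRingHom ℚ)) catalanSeries_sq_mul_X_add_one
  have hm : PowerSeries.map (Nat.castRingHom ℚ) catalanSeries =
      PowerSeries.mk fun n => (catalan n : ℚ) := by
    ext n; simp
  simp only [map_add, map_mul, map_pow, map_one, PowerSeries.map_X, hm] at h
  rw [catY]
  linear_combination -h

lemma catY_sq : catY ^ 2 = catY - X := by
  have h := catalan_series_eq
  have h' : catY = X * PowerSeries.mk fun n => (catalan n : ℚ) := rfl
  linear_combination (-X : ℚ⟦X⟧) * h + (catY - 1) * h'

lemma derivative_catY : d⁄dX ℚ catY = centralSeries := by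
  ext n
  rw [PowerSeries.coeff_derivative, catY, PowerSeries.coeff_succ_X_mul, centralSeries,
    PowerSeries.coeff_mk, PowerSeries.coeff_mk]
  have := succ_mul_catalan_eq_centralBinom n
  rw [← this]; push_cast; ring

/-- Differentiate `y^2 = y - X`, using `y' = B`. -/
lemma centralSeries_mul : centralSeries * (1 - 2 * catY) = 1 := by
  have h := congrArg (d⁄dX ℚ) catY_sq
  rw [pow_two, map_sub, Derivation.leibniz, derivative_catY, PowerSeries.derivative_X] at h
  simp only [smul_eq_mul] at h
  linear_combination -h

lemma centralSeries_sq_mul : centralSeries ^ 2 * (1 - 4 * X) = 1 := by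
  have h := centralSeries_mul
  linear_combination (centralSeries * (1 - 2 * catY) + 1) * h - 4 * centralSeries ^ 2 * catY_sq

lemma coeff_centralSeries_sq (n : ℕ) : coeff n (centralSeries ^ 2) = 4 ^ n := by
  induction n with
  | zero => simp [centralSeries]
  | succ n ih =>
    have h := congrArg (coeff (n + 1)) centralSeries_sq_mul
    have e : centralSeries ^ 2 * (1 - 4 * X) =
        centralSeries ^ 2 - C (4 : ℚ) * (centralSeries ^ 2 * X) := by
      rw [show (C (4 : ℚ) : ℚ⟦X⟧) = 4 from map_ofNat C 4]; ring
    rw [e, map_sub, coeff_C_mul, coeff_succ_mul_X, ih, coeff_one, if_neg n.succ_ne_zero] at h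
    rw [pow_succ (4 : ℚ)]; linarith

/-- Differentiating `B(1-2y) = 1` gives `B' = 2B^3`, so the cube is read off from the coefficients
of `B'`. -/
lemma coeff_centralSeries_cube (n : ℕ) :
    coeff n (centralSeries ^ 3) = ((2 * n + 1) * Nat.centralBinom n : ℚ) := by
  have h := congrArg (d⁄dX ℚ) centralSeries_mul
  have e : d⁄dX ℚ (1 - 2 * catY) = -(2 * centralSeries) := by
    rw [two_mul, map_sub, map_add, derivative_catY, Derivation.map_one_eq_zero]
    ring
  rw [Derivation.leibniz, e] at h
  simp only [smul_eq_mul, Derivation.map_one_eq_zero] at h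
  have h2 : d⁄dX ℚ centralSeries = C (2 : ℚ) * centralSeries ^ 3 := by
    rw [show (C (2 : ℚ) : ℚ⟦X⟧) = 2 from map_ofNat C 2]
    linear_combination centralSeries * h - (d⁄dX ℚ centralSeries) * centralSeries_mul
  have h3 := congrArg (coeff n) h2
  rw [PowerSeries.coeff_derivative, coeff_C_mul, centralSeries, PowerSeries.coeff_mk,
    ← centralSeries] at h3
  have h4 : ((n + 1 : ℕ) * Nat.centralBinom (n + 1) : ℚ) =
      ((2 * (2 * n + 1) * Nat.centralBinom n : ℕ) : ℚ) := by
    rw [← Nat.succ_mul_centralBinom_succ]; push_cast; ring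
  push_cast at h4
  linarith

/-- Uniqueness for the homogeneous recurrence: any solution with the right boundary values and the
right vanishing low coefficients is the one sought, so closed forms need only be verified. -/
lemma series_family_eq_zero (K : ℕ → ℚ⟦X⟧) (h0 : K 0 = K 1)
    (hs : ∀ t, K (t + 1) = K (t + 2) + X * K t)
    (hlow : ∀ t n, n < t → coeff n (K t) = 0) (t : ℕ) : K t = 0 := by
  have main : ∀ n t, coeff n (K t) = 0 := by
    intro n
    induction n with
    | zero =>
      intro t
      rcases t with _ | t
      · rw [h0]; exact hlow _ _ (by omega)
      · exact hlow _ _ (by omega)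
    | succ n ih =>
      -- Descending induction on `t`: for large `t` the coefficient vanishes by `hlow`, and `d`
      -- bounds the distance to that range.
      have pos : ∀ d t, n + 2 ≤ t + 1 + d → coeff (n + 1) (K (t + 1)) = 0 := by
        intro d
        induction d with
        | zero => intro t ht; exact hlow _ _ (by omega)
        | succ d ihd =>
          intro t ht
          rw [hs, map_add, coeff_succ_X_mul, ih, ihd (t + 1) (by omega), add_zero]
      intro t
      rcases t with _ | t
      · rw [h0]; exact pos (n + 2) 0 (by omega)
      · exact pos (n + 2) t (by omega)
  ext n
  simpa using main n t

lemma coeff_mul_catY_pow (f : ℚ⟦X⟧) {n t : ℕ} (h : n < t) : coeff n (f * catY ^ t) = 0 := by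
  rw [catY, mul_pow, mul_left_comm]
  rw [PowerSeries.coeff_X_pow_mul', if_neg (by omega)]

/-- Solution of the unweighted recurrence. -/
lemma count_series_eq (A : ℕ → ℚ⟦X⟧) (h0 : A 0 = A 1 + 1)
    (hs : ∀ t, A (t + 1) = A (t + 2) + X * A t)
    (hlow : ∀ t n, n < t → coeff n (A t) = 0) (t : ℕ) :
    A t = (PowerSeries.mk fun n => (catalan n : ℚ)) * catY ^ t := by
  set c : ℚ⟦X⟧ := PowerSeries.mk fun n => (catalan n : ℚ) with hc
  have := series_family_eq_zero (fun t => A t - c * catY ^ t) ?_ ?_ ?_ t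
  · exact sub_eq_zero.mp this
  · have h := catalan_series_eq
    rw [← hc] at h
    linear_combination h0 - h
  · intro t
    linear_combination hs t + (c * catY ^ t) * catY_sq
  · intro t n h
    simp only [map_sub, hlow t n h, coeff_mul_catY_pow c h, sub_zero]

/-- Solution of the weighted recurrence, from a solution `r` of the recurrence with constant
coefficients. -/
lemma weight_series_eq (W A : ℕ → ℚ⟦X⟧) (w : ℕ → ℚ) (h0 : W 0 = W 1)
    (hA : ∀ t, A t = (PowerSeries.mk fun n => (catalan n : ℚ)) * catY ^ t)
    (hs : ∀ t, W (t + 1) = W (t + 2) + X * W t + X * (C (w (t + 1)) * A (t + 1)))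
    (hlow : ∀ t n, n < t → coeff n (W t) = 0) (r : ℕ → ℚ⟦X⟧)
    (hr0 : r 0 = r 1 * catY)
    (hr : ∀ t, r (t + 1) = r (t + 2) * catY + (1 - catY) * r t + C (w (t + 1)) * catY) (t : ℕ) :
    W t = r t * catY ^ t := by
  have hc : catY = X * PowerSeries.mk fun n => (catalan n : ℚ) := rfl
  set c : ℚ⟦X⟧ := PowerSeries.mk fun n => (catalan n : ℚ)
  have := series_family_eq_zero (fun t => W t - r t * catY ^ t) ?_ ?_ ?_ t
  · exact sub_eq_zero.mp this
  · linear_combination h0 - hr0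
  · intro t
    have h := hs t
    rw [hA] at h
    -- Since `X = y(1-y)` and `X * c = y`, a factor `y ^ (t+1)` comes out of every term of the
    -- recurrence.
    linear_combination h + (-catY ^ (t + 1)) * hr t + r t * catY ^ t * catY_sq -
      C (w (t + 1)) * catY ^ (t + 1) * hc
  · intro t n h
    simp only [map_sub, hlow t n h, coeff_mul_catY_pow (r t) h, sub_zero]

lemma C_natCast (t : ℕ) : (C (t : ℚ) : ℚ⟦X⟧) = (t : ℚ⟦X⟧) := map_natCast C t

/-- The solution for the weight `t`. -/
lemma linear_weight_series_eq (W A : ℕ → ℚ⟦X⟧) (h0 : W 0 = W 1)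
    (hA : ∀ t, A t = (PowerSeries.mk fun n => (catalan n : ℚ)) * catY ^ t)
    (hs : ∀ t, W (t + 1) = W (t + 2) + X * W t + X * (C ((t + 1 : ℕ) : ℚ) * A (t + 1)))
    (hlow : ∀ t n, n < t → coeff n (W t) = 0) :
    W 0 = C (1 / 4 : ℚ) * (centralSeries - 1) ^ 2 := by
  have hB := centralSeries_mul
  have h4 : (C (1 / 4 : ℚ) : ℚ⟦X⟧) * 4 = 1 := by
    rw [← map_ofNat C 4, ← map_mul]; norm_num
  have := weight_series_eq W A (fun t => (t : ℚ)) h0 hA hs hlow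
    -- Constants solve the homogeneous recurrence for `r`, so a weight of degree 1 calls for `r` of
    -- degree 2 in `t`. Comparing powers of `t` gives all but the constant term, which `r 0 = r 1 *
    -- y` fixes.
    (fun t => C (1 / 4 : ℚ) * (centralSeries - 1) *
      ((t : ℚ⟦X⟧) ^ 2 + centralSeries * t + centralSeries - 1)) ?_ ?_ 0
  · rw [this]; push_cast; ring
  · push_cast
    linear_combination C (1 / 4 : ℚ) * (centralSeries - 1) * hB
  · intro t
    rw [C_natCast]
    push_cast
    linear_combination C (1 / 4 : ℚ) * (2 * t + 1 + centralSeries) * hB + (t + 1) * catY * h4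

/-- The solution for the weight `t.choose 2`. -/
lemma choose_two_weight_series_eq (W A : ℕ → ℚ⟦X⟧) (h0 : W 0 = W 1)
    (hA : ∀ t, A t = (PowerSeries.mk fun n => (catalan n : ℚ)) * catY ^ t)
    (hs : ∀ t, W (t + 1) =
      W (t + 2) + X * W t + X * (C (((t + 1).choose 2 : ℕ) : ℚ) * A (t + 1)))
    (hlow : ∀ t n, n < t → coeff n (W t) = 0) :
    W 0 = C (1 / 8 : ℚ) * (centralSeries - 1) ^ 3 := by
  have hB := centralSeries_mul
  have h24 : (C (1 / 24 : ℚ) : ℚ⟦X⟧) * 24 = 1 := by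
    rw [← map_ofNat C 24, ← map_mul]; norm_num
  have h8 : (C (1 / 8 : ℚ) : ℚ⟦X⟧) = C (1 / 24 : ℚ) * 3 := by
    rw [← map_ofNat C 3, ← map_mul]; norm_num
  have := weight_series_eq W A (fun t => (t.choose 2 : ℚ)) h0 hA hs hlow
    -- The same ansatz, now of degree 3 because the weight is quadratic.
    (fun t => C (1 / 24 : ℚ) * (centralSeries - 1) *
      (2 * (t : ℚ⟦X⟧) ^ 3 + 3 * (centralSeries - 1) * t ^ 2 +
        (3 * (centralSeries - 1) * centralSeries - 2) * t + 3 * (centralSeries - 1) ^ 2)) ?_ ?_ 0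
  · rw [this, h8]; push_cast; ring
  · push_cast
    linear_combination 3 * C (1 / 24 : ℚ) * (centralSeries - 1) ^ 2 * hB
  · intro t
    have hw : (C ((t + 1).choose 2 : ℚ) : ℚ⟦X⟧) = C (1 / 24 : ℚ) * 12 * ((t + 1) * t) := by
      rw [Nat.cast_choose_two, ← map_natCast C t, ← map_one C, ← map_ofNat C 12, ← map_add,
        ← map_mul, ← map_mul, ← map_mul]
      congr 1; push_cast; ring
    rw [hw]
    push_cast
    linear_combination C (1 / 24 : ℚ) * (6 * t ^ 2 + 6 * t + 3 * (centralSeries - 1) * (2 * t + 1)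
      + 3 * (centralSeries - 1) * centralSeries) * hB

end Series
end PatternTotals

namespace PatternTotals

open PowerSeries

/-! ### Decomposition of 123-avoiders by their first entry. -/

section Recursion

/-- The permutation of `Fin (n + 1)` with first entry `v` whose remaining entries are in the same
relative order as those of `p`. -/
def prepend {n : ℕ} (v : Fin (n + 1)) (p : Equiv.Perm (Fin n)) : Equiv.Perm (Fin (n + 1)) :=
  (finSuccEquiv' 0).trans ((Equiv.optionCongr p).trans (finSuccEquiv' v).symm)

@[simp]
lemma prepend_zero {n : ℕ} (v : Fin (n + 1)) (p : Equiv.Perm (Fin n)) : prepend v p 0 = v := by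
  simp [prepend]

@[simp]
lemma prepend_succ {n : ℕ} (v : Fin (n + 1)) (p : Equiv.Perm (Fin n)) (i : Fin n) :
    prepend v p i.succ = v.succAbove (p i) := by
  have : finSuccEquiv' (0 : Fin (n + 1)) i.succ = some i := by
    rw [← Fin.zero_succAbove, finSuccEquiv'_succAbove]
  simp [prepend, this]

lemma prepend_bijective (n : ℕ) :
    Function.Bijective fun x : Fin (n + 1) × Equiv.Perm (Fin n) => prepend x.1 x.2 := by
  rw [Fintype.bijective_iff_injective_and_card]
  constructor
  · rintro ⟨v, p⟩ ⟨v', p'⟩ h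
    have hv : v = v' := by simpa using congrArg (fun e => e 0) h
    subst hv
    have hp : p = p' := by
      ext i
      have := congrArg (fun e => e i.succ) h
      simp only [prepend_succ, Fin.succAbove_right_inj] at this
      rw [this]
    rw [hp]
  · simp [Fintype.card_perm, Nat.factorial_succ]

lemma sum_perm_succ {n : ℕ} (f : Equiv.Perm (Fin (n + 1)) → ℚ) :
    ∑ p, f p = ∑ v : Fin (n + 1), ∑ p : Equiv.Perm (Fin n), f (prepend v p) := by
  rw [← Fintype.sum_prod_type' (f := fun v p => f (prepend v p))]
  exact (Fintype.sum_bijective _ (prepend_bijective n) _ _ fun _ => rfl).symm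

/-- The 123-avoiding permutations of length `n` whose `t` largest entries are in decreasing
order. -/
def topDecreasing (n t : ℕ) : Finset (Equiv.Perm (Fin n)) :=
  {p | (∀ i j k, i < j → j < k → p i < p j → ¬ p j < p k) ∧ t ≤ n ∧
    ∀ i j, i < j → p i < p j → (p i : ℕ) + t < n}

lemma mem_topDecreasing {n t : ℕ} {p : Equiv.Perm (Fin n)} :
    p ∈ topDecreasing n t ↔ (∀ i j k, i < j → j < k → p i < p j → ¬ p j < p k) ∧ t ≤ n ∧
      ∀ i j, i < j → p i < p j → (p i : ℕ) + t < n := by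
  simp [topDecreasing]

lemma topDecreasing_eq_empty {n t : ℕ} (h : n < t) : topDecreasing n t = ∅ := by
  ext p
  simp only [mem_topDecreasing, Finset.notMem_empty, iff_false]
  omega

/-- The maximum never starts a noninversion, so `t = 1` imposes nothing on a nonempty permutation.
-/
lemma topDecreasing_succ_zero (n : ℕ) : topDecreasing (n + 1) 0 = topDecreasing (n + 1) 1 := by
  ext p
  simp only [mem_topDecreasing]
  refine and_congr_right fun _ => ⟨fun h => ⟨by omega, fun i j hij hp => ?_⟩,
    fun h => ⟨by omega, fun i j hij hp => by omega⟩⟩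
  have := (p j).isLt
  have : (p i : ℕ) < p j := hp
  omega

lemma prepend_last_mem {n t : ℕ} {p : Equiv.Perm (Fin n)} :
    prepend (Fin.last n) p ∈ topDecreasing (n + 1) (t + 1) ↔ p ∈ topDecreasing n t := by
  simp only [mem_topDecreasing, Fin.forall_fin_succ, prepend_zero, prepend_succ,
    Fin.succ_lt_succ_iff, Fin.succAbove_last, Fin.castSucc_lt_castSucc_iff, Fin.val_castSucc]
  have h (x : Fin n) : ¬ Fin.last n < x.castSucc := by simp [Fin.le_last]
  simp only [h, lt_irrefl, Fin.not_lt_zero, imp_true_iff, true_and,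
    IsEmpty.forall_iff]
  refine and_congr (by simp) (and_congr (by omega) ?_)
  simp only [← add_assoc, add_lt_add_iff_right]

/-- Avoiding 123 through the first entry forces the `n - v` entries above it to decrease. As that
entry starts a noninversion, it must lie below the `t + 1` largest. -/
lemma prepend_castSucc_mem {n t : ℕ} {v : Fin n} {p : Equiv.Perm (Fin n)} :
    prepend v.castSucc p ∈ topDecreasing (n + 1) (t + 1) ↔
      p ∈ topDecreasing n (n - v) ∧ t + v < n := by
  have hlt (x : Fin n) : v.castSucc < v.castSucc.succAbove x ↔ v ≤ x := by
    rw [Fin.lt_succAbove_iff_le_castSucc, Fin.castSucc_le_castSucc_iff]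
  have hval (x : Fin n) (h : x < v) : (v.castSucc.succAbove x : ℕ) = x := by
    rw [Fin.succAbove_of_castSucc_lt _ _ (by simpa using h), Fin.val_castSucc]
  have hv := v.isLt
  simp only [mem_topDecreasing, Fin.forall_fin_succ, prepend_zero, prepend_succ,
    Fin.succ_lt_succ_iff, Fin.succAbove_lt_succAbove_iff, hlt, Fin.not_lt_zero,
    Fin.succ_pos, false_imp_iff, imp_true_iff, true_and, forall_true_left, Fin.val_castSucc]
  constructor
  · rintro ⟨⟨h1, h2⟩, h3, h4, h5⟩
    -- The entry just above the first one witnesses that noninversion.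
    have := h4 (p.symm v) (by simp)
    refine ⟨⟨h2, by omega, fun i j hij hp => ?_⟩, by omega⟩
    by_contra hc
    exact h1 i j hij (Fin.le_def.mpr (by omega)) hp
  · rintro ⟨⟨h2, h3, h4⟩, h5⟩
    refine ⟨⟨fun j k hjk hj hp => ?_, h2⟩, by omega, fun j _ => by omega, fun i j hij hp => ?_⟩
    · have := h4 j k hjk hp
      have : (v : ℕ) ≤ p j := hj
      omega
    · have := h4 i j hij hp
      rw [hval _ (Fin.lt_def.mpr (by omega))]
      omega

lemma sum_topDecreasing_succ {n t : ℕ} (f : Equiv.Perm (Fin (n + 1)) → ℚ) :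
    ∑ p ∈ topDecreasing (n + 1) (t + 1), f p =
      (∑ v : Fin n, if t + v < n then
        ∑ p ∈ topDecreasing n (n - v), f (prepend v.castSucc p) else 0) +
      ∑ p ∈ topDecreasing n t, f (prepend (Fin.last n) p) := by
  have h {m : ℕ} (s : Finset (Equiv.Perm (Fin m))) (g : Equiv.Perm (Fin m) → ℚ) :
      ∑ p ∈ s, g p = ∑ p, if p ∈ s then g p else 0 := by simp
  rw [h, sum_perm_succ, Fin.sum_univ_castSucc, h (topDecreasing n t)]
  simp only [prepend_last_mem, prepend_castSucc_mem]
  congr 1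
  refine Finset.sum_congr rfl fun v _ => ?_
  split_ifs with hv
  · simp [hv]
  · simp [hv]

/-- The number of entries to the right of position `i` that are larger than the entry at `i`. -/
def upCount {n : ℕ} (p : Equiv.Perm (Fin n)) (i : Fin n) : ℕ :=
  (Finset.univ.filter fun j => i < j ∧ p i < p j).card

lemma upCount_prepend_succ {n : ℕ} (v : Fin (n + 1)) (p : Equiv.Perm (Fin n)) (i : Fin n) :
    upCount (prepend v p) i.succ = upCount p i := by
  rw [upCount, upCount, Fin.card_filter_univ_succ]
  simp [Fin.succAbove_lt_succAbove_iff]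

lemma upCount_prepend_zero {n : ℕ} (v : Fin (n + 1)) (p : Equiv.Perm (Fin n)) :
    upCount (prepend v p) 0 = n - v := by
  rw [upCount]
  have : (Finset.univ.filter fun j => 0 < j ∧ prepend v p 0 < prepend v p j) =
      (Finset.Ioi v).map (prepend v p).symm.toEmbedding := by
    ext j
    simp only [Finset.mem_filter, Finset.mem_univ, true_and, prepend_zero, Finset.mem_map_equiv,
      Equiv.symm_symm, Finset.mem_Ioi, and_iff_right_iff_imp]
    intro h
    refine Fin.pos_iff_ne_zero.mpr fun h0 => ?_
    rw [h0, prepend_zero] at h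
    exact lt_irrefl _ h
  rw [this, Finset.card_map, Fin.card_Ioi]
  omega

/-- The sum of a weight of the numbers `upCount p i`. -/
def upSum (w : ℕ → ℚ) {n : ℕ} (p : Equiv.Perm (Fin n)) : ℚ := ∑ i, w (upCount p i)

lemma upSum_prepend (w : ℕ → ℚ) {n : ℕ} (v : Fin (n + 1)) (p : Equiv.Perm (Fin n)) :
    upSum w (prepend v p) = w (n - v) + upSum w p := by
  simp [upSum, Fin.sum_univ_succ, upCount_prepend_succ, upCount_prepend_zero]

/-- The sums differ only at `v = n - (t + 1)`; if no such `v` exists, `hg` makes the extra term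
zero. -/
lemma sum_ite_step {n t : ℕ} (g : ℕ → ℚ) (hg : ∀ s, n < s → g s = 0) :
    (∑ v : Fin n, if t + v < n then g (n - v) else 0) =
      (∑ v : Fin n, if t + 1 + v < n then g (n - v) else 0) + g (t + 1) := by
  have h : g (t + 1) = ∑ v : Fin n, if t + v + 1 = n then g (n - v) else 0 := by
    by_cases ht : t < n
    · rw [Finset.sum_eq_single (⟨n - 1 - t, by omega⟩ : Fin n)]
      · rw [if_pos (by simp only; omega)]
        congr 1; simp only; omega
      · intro b _ hb
        refine if_neg fun h => hb (Fin.ext ?_)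
        simp only; omega
      · simp
    · rw [hg _ (by omega)]
      exact (Finset.sum_eq_zero fun v _ => if_neg (by omega)).symm
  rw [h, ← Finset.sum_add_distrib]
  refine Finset.sum_congr rfl fun v _ => ?_
  split_ifs <;> first | omega | simp

/-! ### Recurrences for the generating functions and the resulting totals. -/

/-- The generating function of the numbers of elements of `topDecreasing n t`. -/
noncomputable def countSeries (t : ℕ) : ℚ⟦X⟧ :=
  PowerSeries.mk fun n => ((topDecreasing n t).card : ℚ)

/-- The generating function of the totals of `upSum w` on `topDecreasing n t`. -/
noncomputable def weightSeries (w : ℕ → ℚ) (t : ℕ) : ℚ⟦X⟧ :=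
  PowerSeries.mk fun n => ∑ p ∈ topDecreasing n t, upSum w p

/-- Subtracting the first-entry decompositions for `t` and `t + 1` leaves one value of `v`, whose
term cancels the maximum-first term for `t + 1`. -/
lemma card_topDecreasing_succ (n t : ℕ) :
    ((topDecreasing (n + 1) (t + 1)).card : ℚ) =
      (topDecreasing (n + 1) (t + 2)).card + (topDecreasing n t).card := by
  have h (s : ℕ) := sum_topDecreasing_succ (n := n) (t := s) fun _ => 1
  simp only [Finset.sum_const, nsmul_eq_mul, mul_one] at h
  rw [h t, h (t + 1), sum_ite_step (fun s => ((topDecreasing n s).card : ℚ))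
    fun s hs => by simp [topDecreasing_eq_empty hs]]

lemma sum_upSum_topDecreasing_succ (w : ℕ → ℚ) (hw : w 0 = 0) (n t : ℕ) :
    ∑ p ∈ topDecreasing (n + 1) (t + 1), upSum w p =
      ∑ p ∈ topDecreasing (n + 1) (t + 2), upSum w p + ∑ p ∈ topDecreasing n t, upSum w p +
        w (t + 1) * (topDecreasing n (t + 1)).card := by
  have h (s : ℕ) := sum_topDecreasing_succ (n := n) (t := s) fun p => upSum w p
  simp only [upSum_prepend, Fin.val_castSucc, Fin.val_last, Nat.sub_self, hw, zero_add] at h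
  rw [h t, h (t + 1), sum_ite_step (fun s => ∑ p ∈ topDecreasing n s, (w s + upSum w p))
    fun s hs => by simp [topDecreasing_eq_empty hs]]
  simp only [Finset.sum_add_distrib, Finset.sum_const, nsmul_eq_mul]
  ring

/-- The `1` is the empty permutation, which `t ≤ n` excludes for `t = 1`; its `upSum` is zero, so
the weighted analogue has no such term. -/
lemma countSeries_zero : countSeries 0 = countSeries 1 + 1 := by
  ext n
  rcases n with _ | n
  · have : topDecreasing 0 0 = Finset.univ := by
      ext p; simp [mem_topDecreasing, Subsingleton.elim p 1]
    simp [countSeries, topDecreasing_eq_empty, this]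
  · simp [countSeries, topDecreasing_succ_zero, coeff_one]

lemma countSeries_eq (t : ℕ) :
    countSeries t = (PowerSeries.mk fun n => (catalan n : ℚ)) * catY ^ t := by
  refine count_series_eq countSeries countSeries_zero (fun t => ?_) (fun t n h => ?_) t
  · ext n
    rcases n with _ | n
    · simp [countSeries, topDecreasing_eq_empty]
    · rw [map_add, coeff_succ_X_mul]
      simpa [countSeries] using card_topDecreasing_succ n t
  · simp [countSeries, topDecreasing_eq_empty h]

lemma weightSeries_zero (w : ℕ → ℚ) : weightSeries w 0 = weightSeries w 1 := by
  ext n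
  rcases n with _ | n
  · simp [weightSeries, upSum]
  · simp [weightSeries, topDecreasing_succ_zero]

lemma weightSeries_succ (w : ℕ → ℚ) (hw : w 0 = 0) (t : ℕ) :
    weightSeries w (t + 1) = weightSeries w (t + 2) + X * weightSeries w t +
      X * (C (w (t + 1)) * countSeries (t + 1)) := by
  ext n
  rcases n with _ | n
  · simp [weightSeries, topDecreasing_eq_empty]
  · rw [map_add, map_add, coeff_succ_X_mul, coeff_succ_X_mul, coeff_C_mul]
    simpa [weightSeries, countSeries] using sum_upSum_topDecreasing_succ w hw n t

lemma coeff_weightSeries_of_lt (w : ℕ → ℚ) (t n : ℕ) (h : n < t) :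
    coeff n (weightSeries w t) = 0 := by
  simp [weightSeries, topDecreasing_eq_empty h]

lemma card_topDecreasing_zero (n : ℕ) : ((topDecreasing n 0).card : ℚ) = catalan n := by
  simpa [countSeries] using congrArg (coeff n) (countSeries_eq 0)

lemma sum_upSum_linear {n : ℕ} (hn : n ≠ 0) :
    ∑ p ∈ topDecreasing n 0, upSum (fun t => (t : ℚ)) p =
      4 ^ n / 4 - (Nat.centralBinom n : ℚ) / 2 := by
  have h := congrArg (coeff n) (linear_weight_series_eq (weightSeries fun t => (t : ℚ))
    countSeries (weightSeries_zero _) countSeries_eq (weightSeries_succ _ (by simp))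
    (coeff_weightSeries_of_lt _))
  rw [weightSeries, PowerSeries.coeff_mk, coeff_C_mul,
    show (centralSeries - 1) ^ 2 = centralSeries ^ 2 - centralSeries - centralSeries + 1 by ring,
    map_add, map_sub, map_sub, coeff_centralSeries_sq, coeff_one, if_neg hn, centralSeries,
    PowerSeries.coeff_mk] at h
  rw [h]; ring

lemma sum_upSum_choose_two {n : ℕ} (hn : n ≠ 0) :
    ∑ p ∈ topDecreasing n 0, upSum (fun t => (t.choose 2 : ℚ)) p =
      (n + 2) / 4 * (Nat.centralBinom n : ℚ) - 3 / 8 * 4 ^ n := by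
  have h := congrArg (coeff n) (choose_two_weight_series_eq
    (weightSeries fun t => (t.choose 2 : ℚ))
    countSeries (weightSeries_zero _) countSeries_eq (weightSeries_succ _ (by simp))
    (coeff_weightSeries_of_lt _))
  rw [weightSeries, PowerSeries.coeff_mk, coeff_C_mul,
    show (centralSeries - 1) ^ 3 = centralSeries ^ 3 - centralSeries ^ 2 - centralSeries ^ 2 -
      centralSeries ^ 2 + centralSeries + centralSeries + centralSeries - 1 by ring,
    map_sub, map_add, map_add, map_add, map_sub, map_sub, map_sub, coeff_centralSeries_cube,
    coeff_centralSeries_sq, coeff_one, if_neg hn, centralSeries, PowerSeries.coeff_mk] at h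
  rw [h]; ring

end Recursion
end PatternTotals

namespace PatternTotals

/-! ### Relations between pattern counts. -/

section Patterns

/-- The pattern 213. -/
def p213 : Equiv.Perm (Fin 3) := ⟨![1, 0, 2], ![1, 0, 2], by decide, by decide⟩

/-- The pattern 312. -/
def p312 : Equiv.Perm (Fin 3) := ⟨![2, 0, 1], ![1, 2, 0], by decide, by decide⟩

/-- The positions `i < j < k` carry an occurrence of `q` in `p`. -/
def IsOccurrence {n : ℕ} (q : Equiv.Perm (Fin 3)) (p : Equiv.Perm (Fin n)) (i j k : Fin n) :
    Prop :=
  i < j ∧ j < k ∧ (p i < p j ↔ q 0 < q 1) ∧ (p i < p k ↔ q 0 < q 2) ∧ (p j < p k ↔ q 1 < q 2)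

instance {n : ℕ} (q : Equiv.Perm (Fin 3)) (p : Equiv.Perm (Fin n)) (i j k : Fin n) :
    Decidable (IsOccurrence q p i j k) := by
  unfold IsOccurrence; infer_instance

lemma mem_occurrences_three {n : ℕ} {q : Equiv.Perm (Fin 3)} {p : Equiv.Perm (Fin n)}
    {s : Fin 3 → Fin n} : s ∈ occurrences q p ↔ IsOccurrence q p (s 0) (s 1) (s 2) := by
  simp only [occurrences, Finset.mem_filter, Finset.mem_univ, true_and, IsOccurrence]
  constructor
  · rintro ⟨h1, h2⟩
    exact ⟨h1 _ _ (by decide), h1 _ _ (by decide), h2 _ _, h2 _ _, h2 _ _⟩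
  · rintro ⟨h01, h12, a, b, c⟩
    have key {x y : Fin 3} (hxy : x ≠ y) (hs : s x < s y) (h : p (s x) < p (s y) ↔ q x < q y) :
        p (s y) < p (s x) ↔ q y < q x := by
      have h1 : p (s x) ≠ p (s y) := fun e => hs.ne (p.injective e)
      have h2 : q x ≠ q y := fun e => hxy (q.injective e)
      rw [← not_iff_not, not_lt, not_lt, le_iff_lt_or_eq, le_iff_lt_or_eq, h]
      simp [h1, h2]
    have a' := key (by decide) h01 a
    have b' := key (by decide) (h01.trans h12) b
    have c' := key (by decide) h12 c
    constructor
    · intro i j hij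
      fin_cases i <;> fin_cases j <;>
        first
        | exact absurd hij (by decide)
        | exact h01
        | exact h12
        | exact h01.trans h12
    · intro i j
      fin_cases i <;> fin_cases j <;>
        first
        | exact a
        | exact b
        | exact c
        | exact a'
        | exact b'
        | exact c'
        | simp

/-- Triples of elements as functions on `Fin 3`. -/
def tripleEquiv (α : Type*) : (Fin 3 → α) ≃ α × α × α where
  toFun s := (s 0, s 1, s 2)
  invFun x := ![x.1, x.2.1, x.2.2]
  left_inv s := by ext i; fin_cases i <;> rfl
  right_inv x := rfl

lemma patternCount_eq_sum {n : ℕ} (q : Equiv.Perm (Fin 3)) (p : Equiv.Perm (Fin n)) :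
    patternCount q p = ∑ i, ∑ j, ∑ k, if IsOccurrence q p i j k then 1 else 0 := by
  have : patternCount q p =
      ∑ s : Fin 3 → Fin n, if IsOccurrence q p (s 0) (s 1) (s 2) then 1 else 0 := by
    rw [patternCount, ← Finset.sum_filter, Finset.card_eq_sum_ones]
    congr 1
    ext s
    simp [mem_occurrences_three]
  have h := (tripleEquiv (Fin n)).sum_comp fun x =>
    if IsOccurrence q p x.1 x.2.1 x.2.2 then 1 else 0
  simp only [Fintype.sum_prod_type] at h
  exact this.trans h

lemma isOccurrence_p123 {n : ℕ} {p : Equiv.Perm (Fin n)} {i j k : Fin n} :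
    IsOccurrence p123 p i j k ↔ i < j ∧ j < k ∧ p i < p j ∧ p i < p k ∧ p j < p k := by
  simp [IsOccurrence, p123]

lemma isOccurrence_p132 {n : ℕ} {p : Equiv.Perm (Fin n)} {i j k : Fin n} :
    IsOccurrence p132 p i j k ↔ i < j ∧ j < k ∧ p i < p j ∧ p i < p k ∧ ¬ p j < p k := by
  simp [IsOccurrence, p132]

lemma isOccurrence_p213 {n : ℕ} {p : Equiv.Perm (Fin n)} {i j k : Fin n} :
    IsOccurrence p213 p i j k ↔ i < j ∧ j < k ∧ ¬ p i < p j ∧ p i < p k ∧ p j < p k := by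
  simp [IsOccurrence, p213]

lemma isOccurrence_p231 {n : ℕ} {p : Equiv.Perm (Fin n)} {i j k : Fin n} :
    IsOccurrence p231 p i j k ↔ i < j ∧ j < k ∧ p i < p j ∧ ¬ p i < p k ∧ ¬ p j < p k := by
  simp [IsOccurrence, p231]

lemma isOccurrence_p312 {n : ℕ} {p : Equiv.Perm (Fin n)} {i j k : Fin n} :
    IsOccurrence p312 p i j k ↔ i < j ∧ j < k ∧ ¬ p i < p j ∧ ¬ p i < p k ∧ p j < p k := by
  simp [IsOccurrence, p312]

lemma isOccurrence_p321 {n : ℕ} {p : Equiv.Perm (Fin n)} {i j k : Fin n} :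
    IsOccurrence p321 p i j k ↔ i < j ∧ j < k ∧ ¬ p i < p j ∧ ¬ p i < p k ∧ ¬ p j < p k := by
  simp [IsOccurrence, p321]

lemma mem_Av_p123 {n : ℕ} {p : Equiv.Perm (Fin n)} :
    p ∈ Av n p123 ↔ ∀ i j k, ¬ IsOccurrence p123 p i j k := by
  simp only [Av, Finset.mem_filter, Finset.mem_univ, true_and, Finset.eq_empty_iff_forall_notMem,
    mem_occurrences_three]
  exact ⟨fun h i j k => h ![i, j, k], fun h s => h _ _ _⟩

lemma Av_p123_eq (n : ℕ) : Av n p123 = topDecreasing n 0 := by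
  ext p
  simp only [mem_Av_p123, mem_topDecreasing, isOccurrence_p123]
  constructor
  · intro h
    exact ⟨fun i j k hij hjk h1 h2 => h i j k ⟨hij, hjk, h1, h1.trans h2, h2⟩, by omega,
      fun i _ _ _ => by omega⟩
  · rintro ⟨h, -⟩ i j k ⟨hij, hjk, h1, -, h2⟩
    exact h i j k hij hjk h1 h2

lemma sum_sum_lt_eq_choose_two {n : ℕ} (U : Finset (Fin n)) :
    (∑ j, ∑ k, if j ∈ U ∧ k ∈ U ∧ j < k then 1 else 0) = U.card.choose 2 := by
  have h1 : (∑ j, ∑ k, if j ∈ U ∧ k ∈ U ∧ j < k then 1 else 0) =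
      ∑ j, ∑ k, if j ∈ U ∧ k ∈ U ∧ k < j then 1 else 0 := by
    rw [Finset.sum_comm]
    refine Finset.sum_congr rfl fun j _ => Finset.sum_congr rfl fun k _ => ?_
    congr 1
    simp only [eq_iff_iff]; tauto
  have h2 : (∑ j, ∑ k, if j ∈ U ∧ k ∈ U ∧ j < k then 1 else 0) +
      (∑ j, ∑ k, if j ∈ U ∧ k ∈ U ∧ k < j then 1 else 0) = U.offDiag.card := by
    have h : U.offDiag.card = ∑ x : Fin n × Fin n, if x ∈ U.offDiag then 1 else 0 := by
      rw [Finset.sum_ite_mem, Finset.univ_inter, Finset.card_eq_sum_ones]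
    rw [h, Fintype.sum_prod_type, ← Finset.sum_add_distrib]
    refine Finset.sum_congr rfl fun j _ => ?_
    rw [← Finset.sum_add_distrib]
    refine Finset.sum_congr rfl fun k _ => ?_
    simp only [Finset.mem_offDiag]
    by_cases hj : j ∈ U <;> by_cases hk : k ∈ U <;>
      simp only [hj, hk, true_and, false_and, and_false, if_false, add_zero]
    rcases lt_trichotomy j k with h | h | h
    · simp [h, h.not_gt, h.ne]
    · simp [h]
    · simp [h, h.not_gt, h.ne']
  rw [← h1, Finset.offDiag_card] at h2
  -- The off-diagonal pairs count each unordered pair twice.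
  rw [Nat.choose_two_right, Nat.mul_sub_one, ← h2]
  omega

lemma patternCount_p132_eq {n : ℕ} {p : Equiv.Perm (Fin n)} (hp : p ∈ Av n p123) :
    (patternCount p132 p : ℚ) = upSum (fun t => (t.choose 2 : ℚ)) p := by
  rw [patternCount_eq_sum, Nat.cast_sum, upSum]
  refine Finset.sum_congr rfl fun i _ => ?_
  rw [upCount, ← sum_sum_lt_eq_choose_two]
  congr 1
  refine Finset.sum_congr rfl fun j _ => Finset.sum_congr rfl fun k _ => ?_
  congr 1
  have := mem_Av_p123.mp hp i j k
  rw [isOccurrence_p123] at this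
  simp only [isOccurrence_p132, Finset.mem_filter, Finset.mem_univ, true_and, eq_iff_iff]
  constructor
  · rintro ⟨h1, h2, h3, h4, h5⟩
    exact ⟨⟨h1, h3⟩, ⟨h1.trans h2, h4⟩, h2⟩
  · rintro ⟨⟨h1, h3⟩, ⟨_, h4⟩, h2⟩
    exact ⟨h1, h2, h3, h4, fun h5 => this ⟨h1, h2, h3, h4, h5⟩⟩

lemma sum_range_choose_two (n : ℕ) : ∑ i ∈ Finset.range n, i.choose 2 = n.choose 3 := by
  induction n with
  | zero => rfl
  | succ n ih => rw [Finset.sum_range_succ, ih, Nat.choose_succ_succ' n 2, add_comm]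

lemma sum_increasing_triples (n : ℕ) :
    (∑ i : Fin n, ∑ j : Fin n, ∑ k : Fin n, if i < j ∧ j < k then 1 else 0) = n.choose 3 := by
  have h (i : Fin n) : (∑ j : Fin n, ∑ k : Fin n, if i < j ∧ j < k then 1 else 0) =
      (n - 1 - i).choose 2 := by
    rw [← Fin.card_Ioi, ← sum_sum_lt_eq_choose_two]
    refine Finset.sum_congr rfl fun j _ => Finset.sum_congr rfl fun k _ => ?_
    congr 1
    simp only [Finset.mem_Ioi, eq_iff_iff]
    exact ⟨fun h => ⟨h.1, h.1.trans h.2, h.2⟩, fun h => ⟨h.1, h.2.2⟩⟩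
  simp only [h]
  rw [Fin.sum_univ_eq_sum_range (fun i => (n - 1 - i).choose 2),
    Finset.sum_range_reflect (fun i => i.choose 2), sum_range_choose_two]

/-- Reverse complement. -/
def revComp {n : ℕ} (p : Equiv.Perm (Fin n)) : Equiv.Perm (Fin n) :=
  Fin.revPerm * p * Fin.revPerm

lemma revComp_apply {n : ℕ} (p : Equiv.Perm (Fin n)) (i : Fin n) :
    revComp p i = (p i.rev).rev := rfl

lemma revComp_involutive (n : ℕ) : Function.Involutive (revComp (n := n)) := by
  intro p; ext i; simp [revComp_apply]

/-- An inequality suffices: applied again to the images, it reverses because `revComp` is an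
involution. -/
lemma patternCount_revComp_le {k n : ℕ} (q : Equiv.Perm (Fin k)) (p : Equiv.Perm (Fin n)) :
    patternCount q p ≤ patternCount (revComp q) (revComp p) := by
  refine Finset.card_le_card_of_injOn (fun s i => (s i.rev).rev) ?_ ?_
  · intro s hs
    simp only [occurrences, Finset.coe_filter, Finset.mem_univ, true_and, Set.mem_ofPred_eq] at hs ⊢
    refine ⟨fun i j hij => ?_, fun i j => ?_⟩
    · exact Fin.rev_lt_rev.mpr (hs.1 _ _ (Fin.rev_lt_rev.mpr hij))
    · simp only [revComp_apply, Fin.rev_rev, Fin.rev_lt_rev]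
      exact hs.2 _ _
  · intro s _ s' _ h
    funext i
    simpa using congrFun h i.rev

lemma patternCount_revComp {k n : ℕ} (q : Equiv.Perm (Fin k)) (p : Equiv.Perm (Fin n)) :
    patternCount (revComp q) (revComp p) = patternCount q p := by
  refine le_antisymm ?_ (patternCount_revComp_le q p)
  simpa only [revComp_involutive _ _] using patternCount_revComp_le (revComp q) (revComp p)

lemma patternTotal_revComp {k m n : ℕ} (q : Equiv.Perm (Fin k)) {r : Equiv.Perm (Fin m)}
    (hr : revComp r = r) : patternTotal (revComp q) (Av n r) = patternTotal q (Av n r) := by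
  have hmem (p : Equiv.Perm (Fin n)) : p ∈ Av n r ↔ revComp p ∈ Av n r := by
    simp only [Av, Finset.mem_filter, Finset.mem_univ, true_and, ← Finset.card_eq_zero]
    have := patternCount_revComp r p
    rw [hr, patternCount, patternCount] at this
    rw [this]
  exact (Finset.sum_equiv (revComp_involutive n).toPerm hmem
    fun p _ => (patternCount_revComp q p).symm).symm

lemma patternTotal_p213 (n : ℕ) :
    patternTotal p213 (Av n p123) = patternTotal p132 (Av n p123) := by
  rw [← patternTotal_revComp p132 (r := p123) (by decide)]
  congr 1
  decide

lemma patternTotal_p312 (n : ℕ) :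
    patternTotal p312 (Av n p123) = patternTotal p231 (Av n p123) := by
  rw [← patternTotal_revComp p231 (r := p123) (by decide)]
  congr 1
  decide

lemma sum_patternCount_eq_choose {n : ℕ} {p : Equiv.Perm (Fin n)} (hp : p ∈ Av n p123) :
    patternCount p132 p + patternCount p213 p + patternCount p231 p + patternCount p312 p +
      patternCount p321 p = n.choose 3 := by
  simp only [patternCount_eq_sum, ← sum_increasing_triples, ← Finset.sum_add_distrib]
  refine Finset.sum_congr rfl fun i _ => Finset.sum_congr rfl fun j _ =>
    Finset.sum_congr rfl fun k _ => ?_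
  have h := mem_Av_p123.mp hp i j k
  simp only [isOccurrence_p123, isOccurrence_p132, isOccurrence_p213, isOccurrence_p231,
    isOccurrence_p312, isOccurrence_p321] at h ⊢
  by_cases hij : i < j <;> by_cases hjk : j < k <;> simp only [hij, hjk, true_and, false_and,
    and_false, if_false, if_true, add_zero] at h ⊢
  have h1 : p i < p j → p j < p k → p i < p k := lt_trans
  have h2 : ¬ p i < p j → ¬ p j < p k → ¬ p i < p k := by
    simp only [not_lt]; exact fun a b => b.trans a
  by_cases a : p i < p j <;> by_cases b : p i < p k <;> by_cases c : p j < p k <;>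
    first
    | exact absurd b (h2 a c)
    | exact absurd (h1 a c) b
    | (simp [a, b, c]; done)
    | exact (h (And.intro a (And.intro b c))).elim

lemma upSum_id_eq {n : ℕ} (p : Equiv.Perm (Fin n)) :
    upSum (fun t => (t : ℚ)) p =
      ((∑ i, ∑ j, if i < j ∧ p i < p j then 1 else 0 : ℕ) : ℚ) := by
  simp [upSum, upCount]

/-- Double count of noninversions with a third position: 132 and 213 contain two noninversions, 231
and 312 one, 321 none. -/
lemma sum_noninversions {n : ℕ} {p : Equiv.Perm (Fin n)} (hp : p ∈ Av n p123) :
    (n - 2) * (∑ i, ∑ j, if i < j ∧ p i < p j then 1 else 0) =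
      2 * patternCount p132 p + 2 * patternCount p213 p + patternCount p231 p +
        patternCount p312 p := by
  have lhs : (n - 2) * (∑ i, ∑ j, if i < j ∧ p i < p j then 1 else 0) =
      ∑ i, ∑ j, ∑ k, ((if i < j ∧ j < k ∧ p i < p j then 1 else 0) +
        (if i < j ∧ j < k ∧ p i < p k then 1 else 0) +
        (if i < j ∧ j < k ∧ p j < p k then 1 else 0)) := by
    -- Rename so that `i, j` always carry the noninversion; the free position `k` then ranges over
    -- the complement of `{i, j}`.
    have e2 : (∑ i, ∑ j, ∑ k, if i < j ∧ j < k ∧ p i < p k then 1 else 0) =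
        ∑ i, ∑ j, ∑ k, if i < k ∧ k < j ∧ p i < p j then 1 else 0 :=
      Finset.sum_congr rfl fun i _ => Finset.sum_comm
    have e3 : (∑ i, ∑ j, ∑ k, if i < j ∧ j < k ∧ p j < p k then 1 else 0) =
        ∑ i, ∑ j, ∑ k, if k < i ∧ i < j ∧ p i < p j then 1 else 0 := by
      rw [Finset.sum_comm]
      exact Finset.sum_congr rfl fun i _ => Finset.sum_comm
    simp only [Finset.sum_add_distrib]
    rw [e2, e3]
    simp only [← Finset.sum_add_distrib, Finset.mul_sum]
    refine Finset.sum_congr rfl fun i _ => Finset.sum_congr rfl fun j _ => ?_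
    by_cases h : i < j ∧ p i < p j
    · obtain ⟨hij, hp⟩ := h
      have hc : ∀ k : Fin n, (if i < j ∧ j < k ∧ p i < p j then 1 else 0) +
          (if i < k ∧ k < j ∧ p i < p j then 1 else 0) +
          (if k < i ∧ i < j ∧ p i < p j then 1 else 0) =
          if k ∈ (({i, j} : Finset (Fin n))ᶜ) then 1 else 0 := by
        intro k
        simp only [hij, hp, true_and, and_true, Finset.mem_compl, Finset.mem_insert,
          Finset.mem_singleton]
        split_ifs <;> omega
      simp only [hc]
      rw [Finset.sum_ite_mem, Finset.univ_inter, Finset.sum_const, Finset.card_compl,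
        Finset.card_pair hij.ne, Fintype.card_fin, if_pos ⟨hij, hp⟩, smul_eq_mul]
    · rw [if_neg h, mul_zero]
      refine (Finset.sum_eq_zero fun k _ => ?_).symm
      split_ifs <;> first | rfl | (exfalso; omega)
  rw [lhs]
  simp only [patternCount_eq_sum, Finset.mul_sum, ← Finset.sum_add_distrib]
  refine Finset.sum_congr rfl fun i _ => Finset.sum_congr rfl fun j _ =>
    Finset.sum_congr rfl fun k _ => ?_
  have h := mem_Av_p123.mp hp i j k
  simp only [isOccurrence_p123, isOccurrence_p132, isOccurrence_p213, isOccurrence_p231,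
    isOccurrence_p312] at h ⊢
  by_cases hij : i < j <;> by_cases hjk : j < k <;> simp only [hij, hjk, true_and, false_and,
    and_false, if_false, add_zero, mul_zero] at h ⊢
  have h1 : p i < p j → p j < p k → p i < p k := lt_trans
  have h2 : ¬ p i < p j → ¬ p j < p k → ¬ p i < p k := by
    simp only [not_lt]; exact fun a b => b.trans a
  by_cases a : p i < p j <;> by_cases b : p i < p k <;> by_cases c : p j < p k <;>
    first
    | exact absurd b (h2 a c)
    | exact absurd (h1 a c) b
    | (simp [a, b, c]; done)
    | exact (h (And.intro a (And.intro b c))).elim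

end Patterns
end PatternTotals

namespace PatternTotals

/-! ### Solving for the totals and matching the stated binomial forms. -/

section Totals

lemma total_p132 {n : ℕ} (hn : 1 ≤ n) :
    (patternTotal p132 (Av n p123) : ℚ) =
      (n + 2) / 4 * (Nat.centralBinom n : ℚ) - 3 / 8 * 4 ^ n := by
  rw [← sum_upSum_choose_two (by omega), ← Av_p123_eq, patternTotal, Nat.cast_sum]
  exact Finset.sum_congr rfl fun p hp => patternCount_p132_eq hp

lemma total_noninversions {n : ℕ} (hn : 1 ≤ n) :
    ((n : ℚ) - 2) * (4 ^ n / 4 - (Nat.centralBinom n : ℚ) / 2) =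
      4 * patternTotal p132 (Av n p123) + 2 * patternTotal p231 (Av n p123) := by
  have h1 : ((n - 2 : ℕ) : ℚ) * (4 ^ n / 4 - (Nat.centralBinom n : ℚ) / 2) =
      ((2 * patternTotal p132 (Av n p123) + 2 * patternTotal p213 (Av n p123) +
        patternTotal p231 (Av n p123) + patternTotal p312 (Av n p123) : ℕ) : ℚ) := by
    rw [← sum_upSum_linear (by omega), ← Av_p123_eq]
    simp only [patternTotal, Finset.mul_sum, ← Finset.sum_add_distrib, Nat.cast_sum]
    refine Finset.sum_congr rfl fun p hp => ?_
    rw [upSum_id_eq, ← Nat.cast_mul, sum_noninversions hp]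
  rw [patternTotal_p213, patternTotal_p312] at h1
  -- For `n = 1` the natural `n - 2` truncates to 0, but the other factor vanishes.
  rcases Nat.lt_or_ge n 2 with h | h
  · obtain rfl : n = 1 := by omega
    have : Nat.centralBinom 1 = 2 := rfl
    rw [this] at h1 ⊢
    norm_num at h1 ⊢
    linear_combination h1
  · rw [Nat.cast_sub h] at h1
    push_cast at h1
    linear_combination h1

lemma total_p231 {n : ℕ} (hn : 1 ≤ n) :
    (patternTotal p231 (Av n p123) : ℚ) =
      (n + 4) / 8 * 4 ^ n - (3 * n + 2) / 4 * (Nat.centralBinom n : ℚ) := by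
  have h := total_noninversions hn
  rw [total_p132 hn] at h
  linear_combination (-1 / 2) * h

lemma total_triples (n : ℕ) :
    (n.choose 3 : ℚ) * catalan n =
      2 * patternTotal p132 (Av n p123) + 2 * patternTotal p231 (Av n p123) +
        patternTotal p321 (Av n p123) := by
  have h : (Av n p123).card * n.choose 3 =
      patternTotal p132 (Av n p123) + patternTotal p213 (Av n p123) +
        patternTotal p231 (Av n p123) + patternTotal p312 (Av n p123) +
        patternTotal p321 (Av n p123) := by
    simp only [patternTotal, ← Finset.sum_add_distrib]
    rw [Finset.sum_congr rfl fun p hp => sum_patternCount_eq_choose hp, Finset.sum_const,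
      smul_eq_mul]
  rw [patternTotal_p213, patternTotal_p312] at h
  have h' := congrArg (Nat.cast (R := ℚ)) h
  push_cast at h'
  rw [Av_p123_eq, card_topDecreasing_zero, ← Av_p123_eq] at h'
  linear_combination h'

lemma cast_choose_three (n : ℕ) : (n.choose 3 : ℚ) = n * (n - 1) * (n - 2) / 6 := by
  induction n with
  | zero => simp
  | succ n ih =>
    rw [Nat.choose_succ_succ' n 2, Nat.cast_add, ih, Nat.cast_choose_two]
    push_cast; ring

lemma cast_centralBinom_succ (n : ℕ) :
    (Nat.centralBinom (n + 1) : ℚ) = 2 * (2 * n + 1) / (n + 1) * Nat.centralBinom n := by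
  have h := congrArg (Nat.cast (R := ℚ)) (Nat.succ_mul_centralBinom_succ n)
  push_cast at h
  field_simp
  linear_combination h

lemma cast_catalan (n : ℕ) : (catalan n : ℚ) = Nat.centralBinom n / (n + 1) := by
  have h := congrArg (Nat.cast (R := ℚ)) (succ_mul_catalan_eq_centralBinom n)
  push_cast at h
  field_simp
  linear_combination h

lemma cast_choose_two_mul_add_one (k : ℕ) :
    ((2 * k + 1).choose k : ℚ) = Nat.centralBinom (k + 1) / 2 := by
  have h : Nat.centralBinom (k + 1) = 2 * (2 * k + 1).choose k := by
    rw [Nat.centralBinom_eq_two_mul_choose, show 2 * (k + 1) = 2 * k + 1 + 1 by ring,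
      Nat.choose_succ_succ', Nat.choose_symm_half, ← two_mul]
  rw [h]; push_cast; ring

/-- One step left of the middle of an odd row; the ratio of neighbours is `(k + 1) / (k + 3)`. -/
lemma cast_choose_two_mul_add_three (k : ℕ) :
    ((2 * k + 3).choose k : ℚ) = (k + 1) / (k + 3) * (Nat.centralBinom (k + 2) / 2) := by
  have h := congrArg (Nat.cast (R := ℚ)) (Nat.choose_succ_right_eq (2 * k + 3) k)
  rw [show 2 * k + 3 - k = k + 3 by omega] at h
  push_cast at h
  rw [show 2 * k + 3 = 2 * (k + 1) + 1 by ring] at h ⊢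
  rw [cast_choose_two_mul_add_one] at h
  field_simp
  linear_combination -2 * h

lemma binom_natCast (m k : ℕ) : binom m k = (m.choose k : ℚ) := by
  simp [binom]

end Totals
end PatternTotals

open PatternTotals in
theorem mainTheorem6 :
    (∀ n : ℕ, 1 ≤ n →
      (patternTotal p132 (Av n p123) : ℚ) =
        ((n : ℚ) + 2) / 4 * binom (2 * n) n - 3 * (2 : ℚ) ^ (2 * (n : ℤ) - 3)) ∧
    (∀ n : ℕ, 2 ≤ n →
      (patternTotal p231 (Av n p123) : ℚ) =
        (2 * (n : ℚ) - 1) * binom (2 * n - 3) ((n : ℤ) - 2)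
          - (2 * (n : ℚ) + 1) * binom (2 * n - 1) ((n : ℤ) - 1)
          + ((n : ℚ) + 4) * (2 : ℚ) ^ (2 * (n : ℤ) - 3)) ∧
    (∀ n : ℕ, 1 ≤ n →
      (patternTotal p321 (Av n p123) : ℚ) =
        1 / 6 * binom (2 * n + 5) ((n : ℤ) + 1) * binom (n + 4) 2
          - 5 / 3 * binom (2 * n + 3) n * binom (n + 3) 2
          + 17 / 3 * binom (2 * n + 1) ((n : ℤ) - 1) * binom (n + 2) 2
          - 6 * binom (2 * n - 1) ((n : ℤ) - 2) * binom (n + 1) 2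
          - ((n : ℚ) + 1) * (4 : ℚ) ^ ((n : ℤ) - 1)) := by
  have pow2 (n : ℕ) : (2 : ℚ) ^ (2 * (n : ℤ) - 3) = 4 ^ n / 8 := by
    rw [zpow_sub₀ (by norm_num), zpow_mul, zpow_natCast]; norm_num
  have pow4 (n : ℕ) : (4 : ℚ) ^ ((n : ℤ) - 1) = 4 ^ n / 4 := by
    rw [zpow_sub₀ (by norm_num), zpow_natCast]; norm_num
  refine ⟨fun n hn => ?_, fun n hn => ?_, fun n hn => ?_⟩
  · rw [total_p132 hn, binom_natCast, pow2, Nat.centralBinom_eq_two_mul_choose]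
    ring
  · rw [total_p231 (by omega)]
    obtain ⟨m, rfl⟩ := Nat.exists_eq_add_of_le' hn
    have b1 : binom (2 * (m + 2) - 3) (((m + 2 : ℕ) : ℤ) - 2) =
        (Nat.centralBinom (m + 1) : ℚ) / 2 := by
      rw [show 2 * (m + 2) - 3 = 2 * m + 1 by omega,
        show ((m + 2 : ℕ) : ℤ) - 2 = (m : ℕ) by push_cast; ring, binom_natCast,
        cast_choose_two_mul_add_one]
    have b2 : binom (2 * (m + 2) - 1) (((m + 2 : ℕ) : ℤ) - 1) =
        (Nat.centralBinom (m + 2) : ℚ) / 2 := by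
      rw [show 2 * (m + 2) - 1 = 2 * (m + 1) + 1 by omega,
        show ((m + 2 : ℕ) : ℤ) - 1 = (m + 1 : ℕ) by push_cast; ring, binom_natCast,
        cast_choose_two_mul_add_one]
    rw [b1, b2, pow2, cast_centralBinom_succ (m + 1)]
    push_cast
    field_simp
    ring
  · have h : (patternTotal p321 (Av n p123) : ℚ) = _ :=
      eq_sub_of_add_eq' (total_triples n).symm
    rw [h, total_p132 hn, total_p231 hn, cast_choose_three, cast_catalan]
    obtain ⟨m, rfl⟩ := Nat.exists_eq_add_of_le' hn
    have b1 : binom (2 * (m + 1) + 5) (((m + 1 : ℕ) : ℤ) + 1) =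
        (m + 3) / (m + 5) * ((Nat.centralBinom (m + 4) : ℚ) / 2) := by
      rw [show 2 * (m + 1) + 5 = 2 * (m + 2) + 3 by ring,
        show ((m + 1 : ℕ) : ℤ) + 1 = (m + 2 : ℕ) by push_cast; ring, binom_natCast,
        cast_choose_two_mul_add_three]
      push_cast; ring
    have b2 : binom (2 * (m + 1) + 3) ((m + 1 : ℕ) : ℤ) =
        (m + 2) / (m + 4) * ((Nat.centralBinom (m + 3) : ℚ) / 2) := by
      rw [binom_natCast, cast_choose_two_mul_add_three]
      push_cast; ring
    have b3 : binom (2 * (m + 1) + 1) (((m + 1 : ℕ) : ℤ) - 1) =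
        (m + 1) / (m + 3) * ((Nat.centralBinom (m + 2) : ℚ) / 2) := by
      rw [show 2 * (m + 1) + 1 = 2 * m + 3 by ring,
        show ((m + 1 : ℕ) : ℤ) - 1 = (m : ℕ) by push_cast; ring, binom_natCast,
        cast_choose_two_mul_add_three]
    have b4 : binom (2 * (m + 1) - 1) (((m + 1 : ℕ) : ℤ) - 2) =
        m / (m + 2) * ((Nat.centralBinom (m + 1) : ℚ) / 2) := by
      -- At `m = 0` the lower index is `-1`: `binom` is zero by convention, matching the factor `m`.
      rcases m with _ | m
      · simp [binom]
      · rw [show 2 * (m + 1 + 1) - 1 = 2 * m + 3 by omega,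
          show ((m + 1 + 1 : ℕ) : ℤ) - 2 = (m : ℕ) by push_cast; ring, binom_natCast,
          cast_choose_two_mul_add_three]
        push_cast; ring
    have b5 (k : ℕ) : binom k 2 = k * (k - 1) / 2 := by
      rw [← Nat.cast_choose_two]; exact binom_natCast k 2
    -- Everything becomes a rational multiple of `Nat.centralBinom (m + 1)` plus a multiple of `4 ^
    -- (m + 1)`, leaving a rational identity in `m`.
    rw [b1, b2, b3, b4, b5, b5, b5, b5, pow4, cast_centralBinom_succ (m + 3),
      cast_centralBinom_succ (m + 2), cast_centralBinom_succ (m + 1)]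
    push_cast
    field_simp
    ring
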